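/- Let $d\ge 2$, $\omega=e^{2\pi i/d}$ and let $V=\frac1{\sqrt d}\sum_{j,k=0}^{d-1}\omega^{jk}|j\rangle\langle k|$ be the discrete Fourier matrix. Let $\mathfrak h=\{\sum_j i\alpha_j|j\rangle\langle j| : \alpha_j\in\mathbb R\}$ be the diagonal subalgebra of the real Lie algebra $\mathfrak u(d)$ of skew-Hermitian matrices, let $\mathfrak h'=V\mathfrak hV^{-1}$, and let $\mathfrak m$ be the real Lie algebra generated by $\mathfrak h$ and $\mathfrak h'$. Let $H=\{\mathrm{diag}(e^{i\alpha_0},\dots,e^{i\alpha_{d-1}}) : \alpha_j\in\mathbb R\}\subset U(d)$ and $H'=VHV^{-1}$. Then: 1. $\mathfrak m$ contains $\sigma_x^{(jk)}=i|j\rangle\langle k|+i|k\rangle\langle j|$ and $\sigma_y^{(jk)}=|j\rangle\langle k|-|k\rangle\langle j|$ for all $0\le j<k\le d-1$; 2. $\mathfrak m=\mathfrak u(d)$; 3. $H$ and $H'$ generate the group $U(d)$ (every unitary is a finite product of elements of $H\cup H'$). Let $|\chi_l\rangle=V|l\rangle$. The diagrams of the qudit ZX calculus are built by sequential and parallel composition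 from plain wires, wire crossings, the Z generators $\sum_j|jj\rangle\langle j|$, $\sum_j|j\rangle\langle jj|$, $\sum_j\langle j|$, $\sum_j|j\rangle$, the X generators $\sum_l|\chi_l\chi_l\rangle\langle\chi_l|$, $\sum_l|\chi_l\rangle\langle\chi_l\chi_l|$, $\langle 0|$, $|0\rangle$, the phase gates $\Lambda_Z(\alpha)=|0\rangle\langle0|+\sum_{l=1}^{d-1}e^{i\alpha_l}|l\rangle\langle l|$ and $\Lambda_X(\alpha)=V\Lambda_Z(\alpha)V^{-1}$ for $\alpha\in\mathbb R^{d-1}$, and the gates $V$ and $V^\dagger$; each diagram with $m$ inputs and $n$ outputs denotes a linear map $(\mathbb C^d)^{\otimes m}\to(\mathbb C^d)^{\otimes n}$. Then moreover: 4. the qudit ZX calculus contains every single-qudit unitary: every $U\in U(d)$ is denoted, up to a global phase, by a diagram with one input and one output; 5. the qudit ZX calculus is universal: for all $m,n\ge0$, every linear map $(\mathbb C^d)^{\otimes m}\to(\mathbb C^d)^{\otimes n}$ (in particular every state and every gate) is denoted, up to a nonzero scalar, by a diagram. -/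

import Mathlib

open scoped Matrix

-- the commutator bracket on matrices
attribute [local instance] LieRing.ofAssociativeRing

noncomputable section

namespace QuditZX

/-! ### The Fourier matrix -/

/-- The primitive root of unity `ω = e^{2πi/d}`. -/
def omega (d : ℕ) : ℂ := Complex.exp (2 * Real.pi * Complex.I / d)

/-- The discrete Fourier matrix `V = d^{-1/2} ∑_{j,k} ω^{jk} |j⟩⟨k|`. -/
def fourierMatrix (d : ℕ) : Matrix (Fin d) (Fin d) ℂ :=
  Matrix.of fun j k => ((Real.sqrt d : ℝ) : ℂ)⁻¹ * omega d ^ ((j : ℕ) * (k : ℕ))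

lemma omega_isPrimitiveRoot (d : ℕ) [NeZero d] : IsPrimitiveRoot (omega d) d :=
  Complex.isPrimitiveRoot_exp d (NeZero.ne d)

lemma star_omega_mul (d : ℕ) : star (omega d) * omega d = 1 := by
  have h : ‖omega d‖ = 1 := by
    have : omega d = Complex.exp ((2 * Real.pi / d : ℝ) * Complex.I) := by
      unfold omega; congr 1; push_cast; ring
    rw [this, Complex.norm_exp_ofReal_mul_I]
  rw [Complex.star_def, mul_comm, Complex.mul_conj, Complex.normSq_eq_norm_sq, h]
  norm_num

lemma sum_omega (d : ℕ) [NeZero d] (j k : Fin d) :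
    ∑ l : Fin d, star (omega d) ^ ((l : ℕ) * (j : ℕ)) * omega d ^ ((l : ℕ) * (k : ℕ))
      = if j = k then (d : ℂ) else 0 := by
  have hω := omega_isPrimitiveRoot d
  have h1 : star (omega d) = (omega d)⁻¹ :=
    eq_inv_of_mul_eq_one_left (star_omega_mul d)
  have hne : omega d ≠ 0 := hω.ne_zero (NeZero.ne d)
  set q : ℂ := (omega d)⁻¹ ^ (j : ℕ) * omega d ^ (k : ℕ) with hq
  have hterm : ∀ l : Fin d,
      star (omega d) ^ ((l : ℕ) * (j : ℕ)) * omega d ^ ((l : ℕ) * (k : ℕ)) = q ^ (l : ℕ) := by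
    intro l
    rw [h1, hq, mul_pow, ← pow_mul, ← pow_mul, mul_comm (l : ℕ) j, mul_comm (l : ℕ) k]
  rw [Finset.sum_congr rfl fun l _ => hterm l, Fin.sum_univ_eq_sum_range (fun l => q ^ l) d]
  have hqd : q ^ d = 1 := by
    rw [hq, mul_pow, ← pow_mul, ← pow_mul, mul_comm (j : ℕ), mul_comm (k : ℕ), pow_mul, pow_mul,
      inv_pow, hω.pow_eq_one]
    simp
  split_ifs with hjk
  · subst hjk
    have : q = 1 := by rw [hq, inv_pow, inv_mul_cancel₀ (pow_ne_zero _ hne)]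
    simp [this]
  · have hq1 : q ≠ 1 := by
      intro h
      apply hjk
      rw [hq, inv_pow] at h
      have h2 : omega d ^ (j : ℕ) = omega d ^ (k : ℕ) :=
        ((inv_mul_eq_one₀ (pow_ne_zero _ hne)).mp h)
      exact Fin.ext (hω.pow_inj j.isLt k.isLt h2)
    rw [geom_sum_eq hq1, hqd]
    simp

lemma fourier_mem (d : ℕ) [NeZero d] : fourierMatrix d ∈ Matrix.unitaryGroup (Fin d) ℂ := by
  rw [Matrix.mem_unitaryGroup_iff']
  ext j k
  have hd : (d : ℂ) ≠ 0 := by exact_mod_cast NeZero.ne d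
  have hs : ((Real.sqrt d : ℝ) : ℂ)⁻¹ * ((Real.sqrt d : ℝ) : ℂ)⁻¹ = (d : ℂ)⁻¹ := by
    rw [← mul_inv, ← Complex.ofReal_mul, Real.mul_self_sqrt (Nat.cast_nonneg d)]
    simp
  have h : (star (fourierMatrix d) * fourierMatrix d) j k = (d : ℂ)⁻¹ *
      ∑ l : Fin d, star (omega d) ^ ((l : ℕ) * (j : ℕ)) * omega d ^ ((l : ℕ) * (k : ℕ)) := by
    rw [Matrix.mul_apply, Finset.mul_sum]
    refine Finset.sum_congr rfl fun l _ => ?_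
    rw [← hs]
    simp only [fourierMatrix, Matrix.star_apply, Matrix.of_apply, star_mul', star_pow, star_inv₀,
      Complex.star_def, Complex.conj_ofReal]
    ring
  rw [h, sum_omega, Matrix.one_apply]
  split_ifs
  · exact inv_mul_cancel₀ hd
  · simp

/-- The Fourier matrix as an element of `U(d)`. -/
def fourierU (d : ℕ) [NeZero d] : Matrix.unitaryGroup (Fin d) ℂ := ⟨fourierMatrix d, fourier_mem d⟩

/-! ### The Lie algebra `𝔲(d)` and its generators -/

/-- The real Lie algebra `𝔲(d)` of skew-Hermitian matrices, with the commutator bracket. -/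
def lieU (d : ℕ) : LieSubalgebra ℝ (Matrix (Fin d) (Fin d) ℂ) where
  carrier := {X | Xᴴ = -X}
  zero_mem' := by simp
  add_mem' := by
    intro X Y hX hY
    simp only [Set.mem_ofPred_eq] at *
    rw [Matrix.conjTranspose_add, hX, hY, neg_add]
  smul_mem' := by
    intro c X hX
    simp only [Set.mem_ofPred_eq] at *
    rw [Matrix.conjTranspose_smul, hX]
    simp
  lie_mem' := by
    intro X Y hX hY
    simp only [Set.mem_ofPred_eq] at *
    rw [Ring.lie_def, Matrix.conjTranspose_sub, Matrix.conjTranspose_mul,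
      Matrix.conjTranspose_mul, hX, hY]
    noncomm_ring

/-- The diagonal subalgebra `𝔥 = {∑ⱼ i αⱼ |j⟩⟨j| : αⱼ ∈ ℝ}`. -/
def lieH (d : ℕ) : LieSubalgebra ℝ (Matrix (Fin d) (Fin d) ℂ) where
  carrier := {X | ∃ α : Fin d → ℝ, X = Matrix.diagonal fun j => Complex.I * (α j : ℂ)}
  zero_mem' := ⟨0, by simp⟩
  add_mem' := by
    rintro _ _ ⟨α, rfl⟩ ⟨β, rfl⟩
    exact ⟨α + β, by rw [Matrix.diagonal_add]; congr 1; funext j; simp [mul_add]⟩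
  smul_mem' := by
    rintro c _ ⟨α, rfl⟩
    refine ⟨c • α, ?_⟩
    rw [← Matrix.diagonal_smul]; congr 1; funext j
    simp only [Pi.smul_apply, Complex.real_smul, smul_eq_mul, Complex.ofReal_mul]
    ring
  lie_mem' := by
    rintro _ _ ⟨α, rfl⟩ ⟨β, rfl⟩
    refine ⟨0, ?_⟩
    rw [Ring.lie_def, Matrix.diagonal_mul_diagonal, Matrix.diagonal_mul_diagonal,
      Matrix.diagonal_sub]
    congr 1; funext j
    simp [mul_comm]

/-- The Fourier conjugate `𝔥' = V 𝔥 V⁻¹`. -/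
def lieH' (d : ℕ) [NeZero d] : LieSubalgebra ℝ (Matrix (Fin d) (Fin d) ℂ) where
  carrier := {Y | ∃ X ∈ lieH d, Y = fourierMatrix d * X * (fourierMatrix d)⁻¹}
  zero_mem' := ⟨0, (lieH d).zero_mem, by simp⟩
  add_mem' := by
    rintro _ _ ⟨X, hX, rfl⟩ ⟨Y, hY, rfl⟩
    exact ⟨X + Y, (lieH d).add_mem hX hY, by rw [mul_add, add_mul]⟩
  smul_mem' := by
    rintro c _ ⟨X, hX, rfl⟩
    exact ⟨c • X, (lieH d).smul_mem c hX, by rw [Matrix.mul_smul, Matrix.smul_mul]⟩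
  lie_mem' := by
    rintro _ _ ⟨X, hX, rfl⟩ ⟨Y, hY, rfl⟩
    have hV : (fourierMatrix d)⁻¹ * fourierMatrix d = 1 := by
      rw [Matrix.inv_eq_left_inv (Matrix.mem_unitaryGroup_iff'.mp (fourier_mem d))]
      exact Matrix.mem_unitaryGroup_iff'.mp (fourier_mem d)
    have key : ∀ A B : Matrix (Fin d) (Fin d) ℂ,
        fourierMatrix d * A * (fourierMatrix d)⁻¹ * (fourierMatrix d * B * (fourierMatrix d)⁻¹)
          = fourierMatrix d * (A * B) * (fourierMatrix d)⁻¹ := by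
      intro A B
      calc _ = fourierMatrix d * A * ((fourierMatrix d)⁻¹ * fourierMatrix d) * B * (fourierMatrix d)⁻¹ := by
            simp only [Matrix.mul_assoc]
        _ = _ := by rw [hV, Matrix.mul_one, Matrix.mul_assoc (fourierMatrix d) A B]
    refine ⟨⁅X, Y⁆, (lieH d).lie_mem hX hY, ?_⟩
    rw [Ring.lie_def, Ring.lie_def, key, key, mul_sub, sub_mul]

/-- `σ_x^{(jk)} = i|j⟩⟨k| + i|k⟩⟨j|`. -/
def sigmaX {d : ℕ} (j k : Fin d) : Matrix (Fin d) (Fin d) ℂ :=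
  Matrix.single j k Complex.I + Matrix.single k j Complex.I

/-- `σ_y^{(jk)} = |j⟩⟨k| - |k⟩⟨j|`. -/
def sigmaY {d : ℕ} (j k : Fin d) : Matrix (Fin d) (Fin d) ℂ :=
  Matrix.single j k 1 - Matrix.single k j 1

/-- The Lie subalgebra `𝔪` generated by `𝔥` and `𝔥'`. -/
def lieM (d : ℕ) [NeZero d] : LieSubalgebra ℝ (Matrix (Fin d) (Fin d) ℂ) :=
  LieSubalgebra.lieSpan ℝ _ ((lieH d : Set (Matrix (Fin d) (Fin d) ℂ)) ∪ lieH' d)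

/-! ### The groups `H` and `H'` -/

/-- The diagonal torus `H` of `U(d)`: the matrices `diag(e^{iα₀}, …, e^{iα_{d-1}})`, `αⱼ ∈ ℝ`. -/
def torusH (d : ℕ) : Subgroup (Matrix.unitaryGroup (Fin d) ℂ) where
  carrier := {U | ∃ α : Fin d → ℝ,
    (U : Matrix (Fin d) (Fin d) ℂ) = Matrix.diagonal fun j => Complex.exp (Complex.I * (α j : ℂ))}
  one_mem' := ⟨0, by simp⟩
  mul_mem' := by
    rintro U W ⟨α, hU⟩ ⟨β, hW⟩
    refine ⟨α + β, ?_⟩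
    rw [Matrix.UnitaryGroup.mul_val, hU, hW, Matrix.diagonal_mul_diagonal]
    congr 1; funext j
    rw [← Complex.exp_add]; simp [mul_add]
  inv_mem' := by
    rintro U ⟨α, hU⟩
    refine ⟨-α, ?_⟩
    rw [Matrix.UnitaryGroup.inv_val, hU, Matrix.star_eq_conjTranspose,
      Matrix.diagonal_conjTranspose]
    congr 1; funext j
    simp [← Complex.exp_conj]

/-- The Fourier conjugate `H' = V H V⁻¹`. -/
def torusH' (d : ℕ) [NeZero d] : Subgroup (Matrix.unitaryGroup (Fin d) ℂ) :=
  (torusH d).map (MulAut.conj (fourierU d)).toMonoidHom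

/-! ### The qudit ZX calculus

The state space of `n` qudits has the basis `|x⟩`, `x : Fin n → Fin d`, and a linear map from `m`
qudits to `n` qudits is given by its matrix in these bases. -/

/-- Linear maps from `m` qudits to `n` qudits, as matrices in the computational bases. -/
abbrev QuditMap (d m n : ℕ) : Type := Matrix (Fin n → Fin d) (Fin m → Fin d) ℂ

/-- The parameters `α₁, …, α_{d-1}` of a phase gate. -/
abbrev Angles (d : ℕ) : Type := {j : Fin d // (j : ℕ) ≠ 0} → ℝ

/-- The diagonal entries `1, e^{iα₁}, …, e^{iα_{d-1}}` of a phase gate. -/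
def phase {d : ℕ} (α : Angles d) (j : Fin d) : ℂ :=
  if hj : (j : ℕ) = 0 then 1 else Complex.exp (Complex.I * (α ⟨j, hj⟩ : ℂ))

/-- Diagrams of the qudit ZX calculus from `m` wires to `n` wires: everything built from the
Z (green) and X (red) generators, the Hadamard gate and its adjoint, plain wires and wire crossings,
by plugging (`comp D₂ D₁` is `D₁` followed by `D₂`) and juxtaposition (`tensor`). -/
inductive Diagram (d : ℕ) : ℕ → ℕ → Type
  | empty : Diagram d 0 0
  | wire : Diagram d 1 1
  | cross : Diagram d 2 2
  | copyZ : Diagram d 1 2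
  | mergeZ : Diagram d 2 1
  | counitZ : Diagram d 1 0
  | unitZ : Diagram d 0 1
  | phaseZ (α : Angles d) : Diagram d 1 1
  | copyX : Diagram d 1 2
  | mergeX : Diagram d 2 1
  | counitX : Diagram d 1 0
  | unitX : Diagram d 0 1
  | phaseX (α : Angles d) : Diagram d 1 1
  | had : Diagram d 1 1
  | hadDagger : Diagram d 1 1
  | comp {m k n : ℕ} (D₂ : Diagram d k n) (D₁ : Diagram d m k) : Diagram d m n
  | tensor {m n m' n' : ℕ} (D₁ : Diagram d m n) (D₂ : Diagram d m' n') :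
      Diagram d (m + m') (n + n')

/-- The tensor product of two maps, acting on the first and on the last wires. -/
def tensorMap {d m n m' n' : ℕ} (A : QuditMap d m n) (B : QuditMap d m' n') :
    QuditMap d (m + m') (n + n') :=
  Matrix.of fun y x =>
    A (fun i => y (Fin.castAdd n' i)) (fun i => x (Fin.castAdd m' i)) *
      B (fun i => y (Fin.natAdd n i)) (fun i => x (Fin.natAdd m i))

/-- A `d × d` matrix as a map from one qudit to one qudit. -/
def oneQudit {d : ℕ} (A : Matrix (Fin d) (Fin d) ℂ) : QuditMap d 1 1 :=
  Matrix.of fun y x => A (y 0) (x 0)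

/-- The X basis: `|χ_l⟩ = V|l⟩`, given by its coordinates. -/
def chi {d : ℕ} (l j : Fin d) : ℂ := fourierMatrix d j l

/-- The phase gate `Λ_Z(α₁, …, α_{d-1}) = diag(1, e^{iα₁}, …, e^{iα_{d-1}})`. -/
def LambdaZ {d : ℕ} (α : Angles d) : Matrix (Fin d) (Fin d) ℂ := Matrix.diagonal (phase α)

/-- The phase gate `Λ_X(α₁, …, α_{d-1}) = |χ_0⟩⟨χ_0| + ∑_{l ≥ 1} e^{iα_l} |χ_l⟩⟨χ_l|`. -/
def LambdaX {d : ℕ} (α : Angles d) : Matrix (Fin d) (Fin d) ℂ :=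
  Matrix.of fun j k => ∑ l : Fin d, phase α l * (chi l j * star (chi l k))

/-- The standard interpretation of diagrams as linear maps. -/
def Diagram.interp {d : ℕ} : {m n : ℕ} → Diagram d m n → QuditMap d m n
  | _, _, .empty => 1
  | _, _, .wire => 1
  | _, _, .cross => Matrix.of fun y x => if y 0 = x 1 ∧ y 1 = x 0 then 1 else 0
  -- `∑ⱼ |jj⟩⟨j|`, `∑ⱼ |j⟩⟨jj|`, `∑ⱼ ⟨j|`, `∑ⱼ |j⟩`
  | _, _, .copyZ => Matrix.of fun y x => if y 0 = x 0 ∧ y 1 = x 0 then 1 else 0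
  | _, _, .mergeZ => Matrix.of fun y x => if y 0 = x 0 ∧ y 0 = x 1 then 1 else 0
  | _, _, .counitZ => Matrix.of fun _ _ => 1
  | _, _, .unitZ => Matrix.of fun _ _ => 1
  | _, _, .phaseZ α => oneQudit (LambdaZ α)
  -- `∑_l |χ_l χ_l⟩⟨χ_l|`, `∑_l |χ_l⟩⟨χ_l χ_l|`, `⟨0|`, `|0⟩`
  | _, _, .copyX => Matrix.of fun y x =>
      ∑ l : Fin d, chi l (y 0) * chi l (y 1) * star (chi l (x 0))
  | _, _, .mergeX => Matrix.of fun y x =>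
      ∑ l : Fin d, chi l (y 0) * (star (chi l (x 0)) * star (chi l (x 1)))
  | _, _, .counitX => Matrix.of fun _ x => if (x 0 : ℕ) = 0 then 1 else 0
  | _, _, .unitX => Matrix.of fun y _ => if (y 0 : ℕ) = 0 then 1 else 0
  | _, _, .phaseX α => oneQudit (LambdaX α)
  | _, _, .had => oneQudit (fourierMatrix d)
  | _, _, .hadDagger => oneQudit (fourierMatrix d)ᴴ
  | _, _, .comp D₂ D₁ => D₂.interp * D₁.interp
  | _, _, .tensor D₁ D₂ => tensorMap D₁.interp D₂.interp

end QuditZX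

end

/-!
The double bracket `⁅i|j⟩⟨j|, ⁅i|k⟩⟨k|, X⁆⁆` of a skew-Hermitian `X` keeps only its entries at `jk`
and `kj`. The single element `V (i|0⟩⟨0|) V⁻¹` of `𝔥'` has all entries equal to `i/d`, so it yields
every `σ_x`, one more bracket yields every `σ_y`, and these span `𝔲(d)` together with `𝔥`.

The same selection of entries works inside the group `G` generated by `H` and `H'`, with conjugation
by diagonal signs in place of brackets: the directions `Y` with `exp (ℝY) ⊆ G` span `𝔲(d)`
(`lieU_subset_span_expDirections`). For directions `Y₁, …, Yₙ` that span, the map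
`(t, K) ↦ exp (t₁Y₁) ⋯ exp (tₙYₙ) (1 + K)`, with `K` Hermitian, has surjective derivative at `0`, so
it covers a neighbourhood of `1`; the factor `1 + K` of a unitary value is unitary, Hermitian and
near `1`, hence trivial. So `G` contains a neighbourhood of `1` in `U(d)`
(`eventually_mem_of_lieU_subset_span`), and it is everything because each unitary is a power of a
unitary near `1`.

Since `H`, `V` and `V⁻¹` are available as diagrams up to phase, so are all single-qudit unitaries,
and with `⟨0|` all effects `⟨h|`. For universality, the X multiplication adds labels modulo `d`, so
that `|x⟩ ↦ |x⟩|∑ aᵢxᵢ⟩` is a diagram, and plugging an effect gives the diagonal map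
`h (∑ aᵢxᵢ)`. Products of these maps are the exponentials of Fourier series on `(ℤ/d)ᴺ`, that is,
all diagonal maps without zero entries (`isDenoted_diagonal`). Uniform states and effects on some of
the wires turn a diagonal map into an arbitrary map without zero entries, and a difference of two
such maps is arbitrary.
-/

namespace QuditZX

/-! ### The Lie algebra generated by `𝔥` and `𝔥'` -/

lemma fourierMatrix_inv (d : ℕ) [NeZero d] : (fourierMatrix d)⁻¹ = (fourierMatrix d)ᴴ :=
  Matrix.inv_eq_left_inv (Matrix.mem_unitaryGroup_iff'.mp (fourier_mem d))

/-- The matrix `(i/d) ∑_{j,k} |j⟩⟨k| = V (i|0⟩⟨0|) V⁻¹`. All its off-diagonal entries are nonzero,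
so this one element of `𝔥'` reaches every root space of `𝔥`. -/
noncomputable def allOnes (d : ℕ) : Matrix (Fin d) (Fin d) ℂ :=
  Matrix.of fun _ _ => Complex.I / d

lemma single_I_mem_lieH {d : ℕ} (j : Fin d) : Matrix.single j j Complex.I ∈ lieH d :=
  ⟨Pi.single j 1, by
    rw [← Matrix.diagonal_single]
    congr 1; funext k
    by_cases h : k = j
    · subst h; simp
    · simp [h]⟩

lemma allOnes_eq (d : ℕ) [NeZero d] :
    allOnes d = fourierMatrix d * Matrix.single 0 0 Complex.I * (fourierMatrix d)⁻¹ := by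
  have hs : ((Real.sqrt d : ℝ) : ℂ)⁻¹ * ((Real.sqrt d : ℝ) : ℂ)⁻¹ = (d : ℂ)⁻¹ := by
    rw [← mul_inv, ← Complex.ofReal_mul, Real.mul_self_sqrt (Nat.cast_nonneg d)]
    simp
  ext a b
  rw [fourierMatrix_inv, Matrix.mul_apply, Finset.sum_eq_single 0]
  · simp only [allOnes, Matrix.of_apply, Matrix.mul_single_apply_same,
      Matrix.conjTranspose_apply, fourierMatrix, Fin.val_zero, mul_zero, pow_zero, mul_one,
      star_inv₀, Complex.star_def, Complex.conj_ofReal]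
    rw [div_eq_mul_inv, ← hs]; ring
  · intro c _ hc
    rw [Matrix.mul_single_apply_of_ne _ _ _ _ _ hc, zero_mul]
  · simp

lemma allOnes_mem_lieH' (d : ℕ) [NeZero d] : allOnes d ∈ lieH' d :=
  ⟨_, single_I_mem_lieH 0, allOnes_eq d⟩

/-- Bracketing twice with diagonal matrix units cuts out the two entries at `jk` and `kj`. -/
lemma sigmaX_eq_bracket {d : ℕ} {j k : Fin d} (h : j ≠ k) :
    sigmaX j k = (d : ℝ) • ⁅Matrix.single j j Complex.I,
      ⁅Matrix.single k k Complex.I, allOnes d⁆⁆ := by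
  have hd : (d : ℂ) ≠ 0 := by
    have := j.pos
    exact_mod_cast this.ne'
  rw [Ring.lie_def, Ring.lie_def]
  ext a b
  simp only [sigmaX, mul_sub, sub_mul, Matrix.add_apply, Matrix.sub_apply, Matrix.smul_apply,
    Complex.real_smul, Complex.ofReal_natCast, ← Matrix.diagonal_single, Matrix.diagonal_mul,
    Matrix.mul_diagonal, allOnes, Matrix.of_apply, Matrix.single_apply, Pi.single_apply]
  by_cases haj : a = j <;> by_cases hak : a = k <;> by_cases hbj : b = j <;>
    by_cases hbk : b = k <;> simp_all [eq_comm]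
  all_goals
    field_simp
    simp [pow_succ]

lemma sigmaY_eq_bracket {d : ℕ} {j k : Fin d} (h : j ≠ k) :
    sigmaY j k = - ⁅Matrix.single j j Complex.I, sigmaX j k⁆ := by
  rw [Ring.lie_def]
  ext a b
  simp only [sigmaX, sigmaY, Matrix.add_apply, Matrix.sub_apply, Matrix.neg_apply,
    ← Matrix.diagonal_single, Matrix.diagonal_mul, Matrix.mul_diagonal, Matrix.single_apply,
    Pi.single_apply]
  by_cases haj : a = j <;> by_cases hak : a = k <;> by_cases hbj : b = j <;>
    by_cases hbk : b = k <;> simp_all [eq_comm]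

lemma lieH_le_lieM (d : ℕ) [NeZero d] : lieH d ≤ lieM d := fun _ hX =>
  LieSubalgebra.subset_lieSpan (Or.inl hX)

lemma sigmaX_mem_lieM {d : ℕ} [NeZero d] {j k : Fin d} (h : j ≠ k) : sigmaX j k ∈ lieM d := by
  rw [sigmaX_eq_bracket h]
  exact (lieM d).smul_mem _ <| (lieM d).lie_mem (lieH_le_lieM d (single_I_mem_lieH j)) <|
    (lieM d).lie_mem (lieH_le_lieM d (single_I_mem_lieH k)) <|
      LieSubalgebra.subset_lieSpan (Or.inr (allOnes_mem_lieH' d))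

lemma sigmaY_mem_lieM {d : ℕ} [NeZero d] {j k : Fin d} (h : j ≠ k) : sigmaY j k ∈ lieM d := by
  rw [sigmaY_eq_bracket h]
  exact (lieM d).neg_mem <|
    (lieM d).lie_mem (lieH_le_lieM d (single_I_mem_lieH j)) (sigmaX_mem_lieM h)

/-- A real subspace containing the diagonal matrices of `𝔥` and all `σ_x`, `σ_y` contains all
skew-Hermitian matrices. -/
lemma lieU_le_of_sigma_mem {d : ℕ} (W : Submodule ℝ (Matrix (Fin d) (Fin d) ℂ))
    (hH : ∀ X ∈ lieH d, X ∈ W) (hX : ∀ j k : Fin d, j ≠ k → sigmaX j k ∈ W)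
    (hY : ∀ j k : Fin d, j ≠ k → sigmaY j k ∈ W) : ∀ X ∈ lieU d, X ∈ W := by
  intro X hskew
  have hent : ∀ a b, star (X b a) = - X a b := fun a b => by
    have := congrFun (congrFun (show Xᴴ = -X from hskew) a) b
    simpa using this
  -- Averaging `X` over the two orders of the indices: each off-diagonal pair is counted twice.
  have hsum : X = (Matrix.diagonal fun j => Complex.I * ((X j j).im : ℂ)) +
      ∑ j, ∑ k, if j = k then 0 else
        ((2⁻¹ * (X j k).im : ℝ) • sigmaX j k + (2⁻¹ * (X j k).re : ℝ) • sigmaY j k) := by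
    ext a b
    have hre : (X b a).re = - (X a b).re := by simpa using congrArg Complex.re (hent a b)
    have him : (X b a).im = (X a b).im := by
      simpa using congrArg Complex.im (hent a b)
    simp only [Matrix.add_apply, Matrix.sum_apply]
    by_cases hab : a = b
    · subst hab
      rw [Finset.sum_eq_zero]
      · have : (X a a).re = 0 := by linarith
        apply Complex.ext <;> simp [this]
      · intro j _
        refine Finset.sum_eq_zero fun k _ => ?_
        split_ifs with hjk
        · simp
        · have h1 : ¬ (j = a ∧ k = a) := fun h => hjk (h.1.trans h.2.symm)
          have h2 : ¬ (k = a ∧ j = a) := fun h => hjk (h.2.trans h.1.symm)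
          simp [sigmaX, sigmaY, h1, h2]
    · have key : ∀ j k, (if j = k then (0 : Matrix (Fin d) (Fin d) ℂ) else
          ((2⁻¹ * (X j k).im : ℝ) • sigmaX j k + (2⁻¹ * (X j k).re : ℝ) • sigmaY j k)) a b =
          (if j = a then if k = b then 2⁻¹ * X a b else 0 else 0) +
          (if j = b then if k = a then 2⁻¹ * X a b else 0 else 0) := by
        intro j k
        by_cases hjk : j = k
        · subst hjk
          by_cases h1 : j = a <;> by_cases h2 : j = b <;> simp_all
        · by_cases h1 : j = a
          · subst h1
            by_cases h2 : k = b
            · subst h2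
              apply Complex.ext <;> simp [hjk, sigmaX, sigmaY, Ne.symm hjk]
            · simp [hjk, h2, hab, sigmaX, sigmaY]
          · by_cases h2 : j = b
            · subst h2
              by_cases h3 : k = a
              · subst h3
                apply Complex.ext <;>
                  simp [hjk, sigmaX, sigmaY, Ne.symm hjk, hre, him]
              · simp [hjk, h3, h1, sigmaX, sigmaY]
            · simp [hjk, h2, h1, sigmaX, sigmaY]
      simp only [key, Finset.sum_add_distrib, Finset.sum_ite_eq', Finset.mem_univ, if_true,
        Finset.sum_ite_irrel, Finset.sum_const_zero, Matrix.diagonal_apply_ne _ hab]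
      ring
  rw [hsum]
  refine W.add_mem (hH _ ⟨_, rfl⟩) (W.sum_mem fun j _ => W.sum_mem fun k _ => ?_)
  split_ifs with hjk
  · exact W.zero_mem
  · exact W.add_mem (W.smul_mem _ (hX j k hjk)) (W.smul_mem _ (hY j k hjk))

lemma lieH_le_lieU (d : ℕ) : lieH d ≤ lieU d := by
  rintro _ ⟨α, rfl⟩
  change _ᴴ = -_
  rw [Matrix.diagonal_conjTranspose, Matrix.diagonal_neg]
  congr 1; funext j; simp

lemma lieH'_le_lieU (d : ℕ) [NeZero d] : lieH' d ≤ lieU d := by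
  rintro _ ⟨X, hX, rfl⟩
  have h : Xᴴ = -X := lieH_le_lieU d hX
  change _ᴴ = -_
  simp [fourierMatrix_inv, h, Matrix.mul_assoc]

lemma lieM_eq_lieU (d : ℕ) [NeZero d] : lieM d = lieU d := by
  refine le_antisymm ?_ ?_
  · exact LieSubalgebra.lieSpan_le.mpr
      (Set.union_subset (lieH_le_lieU d) (lieH'_le_lieU d))
  · exact lieU_le_of_sigma_mem (lieM d).toSubmodule (fun X hX => lieH_le_lieM d hX)
      (fun _ _ => sigmaX_mem_lieM) (fun _ _ => sigmaY_mem_lieM)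

/-! ### One-parameter subgroups -/

/-- The matrices `Y` whose one-parameter group `t ↦ exp (tY)` lies in `G`. -/
def expDirections {d : ℕ} (G : Subgroup (Matrix.unitaryGroup (Fin d) ℂ)) :
    Set (Matrix (Fin d) (Fin d) ℂ) :=
  {Y | ∀ t : ℝ, ∃ U ∈ G, (U : Matrix (Fin d) (Fin d) ℂ) = NormedSpace.exp (t • Y)}

section
variable {d : ℕ} {G : Subgroup (Matrix.unitaryGroup (Fin d) ℂ)}

lemma exp_I_smul_diagonal (α : Fin d → ℝ) (t : ℝ) :
    NormedSpace.exp (t • Matrix.diagonal fun j => Complex.I * (α j : ℂ)) =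
      Matrix.diagonal fun j => Complex.exp (Complex.I * ((t * α j : ℝ) : ℂ)) := by
  rw [← Matrix.diagonal_smul, Matrix.exp_diagonal]
  congr 1; funext j
  rw [Pi.coe_exp, ← Complex.exp_eq_exp_ℂ]
  congr 1
  simp only [Pi.smul_apply, Complex.real_smul, Complex.ofReal_mul]
  ring

lemma exists_mem_torusH (α : Fin d → ℝ) : ∃ U ∈ torusH d, (U : Matrix (Fin d) (Fin d) ℂ) =
    Matrix.diagonal fun j => Complex.exp (Complex.I * (α j : ℂ)) := by
  refine ⟨⟨Matrix.diagonal fun j => Complex.exp (Complex.I * (α j : ℂ)), ?_⟩, ⟨α, rfl⟩, rfl⟩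
  rw [Matrix.mem_unitaryGroup_iff, Matrix.star_eq_conjTranspose, Matrix.diagonal_conjTranspose,
    Matrix.diagonal_mul_diagonal, ← Matrix.diagonal_one]
  congr 1; funext j
  simp [← Complex.exp_conj, ← Complex.exp_add]

lemma lieH_subset_expDirections (hG : torusH d ≤ G) : (lieH d : Set _) ⊆ expDirections G := by
  rintro _ ⟨α, rfl⟩ t
  obtain ⟨U, hU, h⟩ := exists_mem_torusH fun j => t * α j
  exact ⟨U, hG hU, by rw [h, exp_I_smul_diagonal]⟩

/-- Conjugating the direction conjugates the one-parameter group. -/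
lemma conj_mem_expDirections {K : Subgroup (Matrix.unitaryGroup (Fin d) ℂ)}
    (U : Matrix.unitaryGroup (Fin d) ℂ) (hU : K.map (MulAut.conj U).toMonoidHom ≤ G)
    {Y : Matrix (Fin d) (Fin d) ℂ} (hY : Y ∈ expDirections K) :
    (U : Matrix (Fin d) (Fin d) ℂ) * Y * (U : Matrix (Fin d) (Fin d) ℂ)ᴴ ∈ expDirections G := by
  intro t
  obtain ⟨W, hW, h⟩ := hY t
  refine ⟨U * W * U⁻¹, hU ⟨W, hW, rfl⟩, ?_⟩
  have hu := Matrix.exp_units_conj (Unitary.toUnits U) (t • Y)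
  rw [← h] at hu
  simp only [← map_inv, Unitary.val_toUnits_apply, Matrix.UnitaryGroup.inv_val,
    Matrix.star_eq_conjTranspose, Matrix.mul_smul, Matrix.smul_mul] at hu
  rw [hu]
  rfl

lemma conj_mem_expDirections_of_mem {U : Matrix.unitaryGroup (Fin d) ℂ} (hU : U ∈ G)
    {Y : Matrix (Fin d) (Fin d) ℂ} (hY : Y ∈ expDirections G) :
    (U : Matrix (Fin d) (Fin d) ℂ) * Y * (U : Matrix (Fin d) (Fin d) ℂ)ᴴ ∈ expDirections G := by
  refine conj_mem_expDirections U ?_ hY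
  rintro _ ⟨W, hW, rfl⟩
  exact G.mul_mem (G.mul_mem hU hW) (G.inv_mem hU)

lemma allOnes_mem_expDirections [NeZero d] (hG' : torusH' d ≤ G) :
    allOnes d ∈ expDirections G := by
  rw [allOnes_eq, fourierMatrix_inv]
  exact conj_mem_expDirections (fourierU d) hG'
    (lieH_subset_expDirections le_rfl (single_I_mem_lieH 0))

/-- The diagonal unitary with entry `e^{iθ}` at `j` and `1` elsewhere, as an element of the torus. -/
lemma exists_phase_mem_torusH (j : Fin d) (θ : ℝ) :
    ∃ U ∈ torusH d, (U : Matrix (Fin d) (Fin d) ℂ) =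
      Matrix.diagonal fun k => if k = j then Complex.exp (Complex.I * θ) else 1 := by
  obtain ⟨U, hU, h⟩ := exists_mem_torusH fun k => if k = j then θ else 0
  refine ⟨U, hU, h.trans ?_⟩
  congr 1; funext k
  split_ifs <;> simp

/-- The directions in `G` span `𝔲(d)`. Signs `-1` at the positions `j` and `k` isolate the entries
`jk` and `kj` of `allOnes` by inclusion-exclusion, which gives `σ_x`; conjugation by `i` at the
position `j` turns `σ_x` into `-σ_y`. -/
lemma lieU_subset_span_expDirections [NeZero d] (hG : torusH d ≤ G) (hG' : torusH' d ≤ G) :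
    ∀ X ∈ lieU d, X ∈ Submodule.span ℝ (expDirections G) := by
  set W := Submodule.span ℝ (expDirections G)
  have hconj : ∀ U ∈ torusH d, ∀ Y ∈ W,
      (U : Matrix (Fin d) (Fin d) ℂ) * Y * (U : Matrix (Fin d) (Fin d) ℂ)ᴴ ∈ W := by
    intro U hU Y hY
    refine Submodule.span_induction (p := fun Y _ => (U : Matrix (Fin d) (Fin d) ℂ) * Y *
      (U : Matrix (Fin d) (Fin d) ℂ)ᴴ ∈ W) ?_ ?_ ?_ ?_ hY
    · intro Y hY
      exact Submodule.subset_span (conj_mem_expDirections_of_mem (hG hU) hY)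
    · simp
    · intro Y Z _ _ h1 h2
      rw [mul_add, add_mul]; exact W.add_mem h1 h2
    · intro c Y _ h
      rw [Matrix.mul_smul, Matrix.smul_mul]; exact W.smul_mem c h
  have hX : ∀ j k : Fin d, j ≠ k → sigmaX j k ∈ W := by
    intro j k hjk
    have h1 : allOnes d ∈ W := Submodule.subset_span (allOnes_mem_expDirections hG')
    obtain ⟨U, hU, hUv⟩ := exists_phase_mem_torusH j Real.pi
    obtain ⟨V, hV, hVv⟩ := exists_phase_mem_torusH k Real.pi
    have h2 := W.sub_mem h1 (hconj U hU _ h1)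
    have h3 := W.smul_mem (d / 4 : ℝ) (W.sub_mem h2 (hconj V hV _ h2))
    convert h3 using 1
    have hd : (d : ℂ) ≠ 0 := by exact_mod_cast NeZero.ne d
    have hpi : Complex.exp (Complex.I * Real.pi) = -1 := by rw [mul_comm, Complex.exp_pi_mul_I]
    rw [hUv, hVv]
    ext a b
    simp only [hpi, sigmaX, Matrix.add_apply, Matrix.sub_apply, Matrix.smul_apply,
      Complex.real_smul, Matrix.diagonal_conjTranspose, Matrix.diagonal_mul, Matrix.mul_diagonal,
      allOnes, Matrix.of_apply, Matrix.single_apply, Pi.star_apply]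
    push_cast
    by_cases haj : a = j
    · subst haj
      have hak : ¬ k = a := fun h => hjk h.symm
      by_cases hbj : b = a
      · subst hbj; simp [hjk, hak]
      · by_cases hbk : b = k
        · subst hbk
          simp [hjk, hak]
          field_simp
          ring
        · simp [hjk, hbj, hbk, Ne.symm hbk, Ne.symm hbj]
    · by_cases hak : a = k
      · subst hak
        by_cases hbj : b = j
        · subst hbj
          simp [hjk, Ne.symm hjk]
          field_simp
          ring
        · by_cases hbk : b = a
          · subst hbk; simp [hjk, Ne.symm hjk]
          · simp [Ne.symm hjk, hbj, hbk, Ne.symm hbj, hjk]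
      · by_cases hbj : b = j
        · subst hbj; simp [haj, hak, Ne.symm haj, Ne.symm hak, hjk]
        · simp [haj, hak, Ne.symm haj, Ne.symm hak, hbj]
  refine lieU_le_of_sigma_mem W
    (fun X h => Submodule.subset_span (lieH_subset_expDirections hG h)) hX ?_
  intro j k hjk
  obtain ⟨U, hU, hUv⟩ := exists_phase_mem_torusH j (Real.pi / 2)
  have h := W.neg_mem (hconj U hU _ (hX j k hjk))
  convert h using 1
  have hpi : Complex.exp (Complex.I * (Real.pi / 2 : ℝ)) = Complex.I := by
    rw [mul_comm]; push_cast; exact Complex.exp_pi_div_two_mul_I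
  rw [hUv]
  ext a b
  simp only [hpi, sigmaX, sigmaY, Matrix.add_apply, Matrix.sub_apply, Matrix.neg_apply,
    Matrix.diagonal_conjTranspose, Matrix.diagonal_mul, Matrix.mul_diagonal,
    Matrix.single_apply, Pi.star_apply]
  simp only [eq_comm (a := j) (b := a), eq_comm (a := j) (b := b), eq_comm (a := k) (b := a),
    eq_comm (a := k) (b := b)]
  by_cases haj : a = j
  · subst haj
    by_cases hbj : b = a
    · subst hbj; simp [hjk]
    · by_cases hbk : b = k <;> simp [hjk, hbj, hbk, Ne.symm hjk]
  · by_cases hbj : b = j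
    · subst hbj
      by_cases hak : a = k <;> simp [hjk, haj, hak, Ne.symm hjk]
    · simp [haj, hbj]

end

/-! ### A subgroup with enough directions is all of `U(d)` -/

section
open scoped Matrix.Norms.L2Operator Topology
open Filter

variable {d : ℕ} {G : Subgroup (Matrix.unitaryGroup (Fin d) ℂ)}

lemma hasStrictFDerivAt_mul_of_eq_one {E A : Type*} [NormedAddCommGroup E] [NormedSpace ℝ E]
    [NormedRing A] [NormedAlgebra ℝ A] {f g : E → A} {f' g' : E →L[ℝ] A} {x : E}
    (hf : HasStrictFDerivAt f f' x) (hg : HasStrictFDerivAt g g' x) (hfx : f x = 1)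
    (hgx : g x = 1) : HasStrictFDerivAt (fun y => f y * g y) (f' + g') x := by
  convert! hf.mul' hg using 1
  ext v
  simp [hfx, hgx, add_comm]

/-- A product of one-parameter groups of `G` is a map into `G` whose derivative at `0` is the
linear combination of the directions. -/
lemma exists_hasStrictFDerivAt_of_expDirections (n : ℕ) (Y : Fin n → Matrix (Fin d) (Fin d) ℂ)
    (hY : ∀ i, Y i ∈ expDirections G) :
    ∃ F : (Fin n → ℝ) → Matrix (Fin d) (Fin d) ℂ,
      (∀ t, ∃ U ∈ G, (U : Matrix (Fin d) (Fin d) ℂ) = F t) ∧ F 0 = 1 ∧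
      ∃ F' : (Fin n → ℝ) →L[ℝ] Matrix (Fin d) (Fin d) ℂ,
        HasStrictFDerivAt F F' 0 ∧ ∀ t, F' t = ∑ i, t i • Y i := by
  induction n with
  | zero =>
    exact ⟨fun _ => 1, fun _ => ⟨1, G.one_mem, rfl⟩, rfl, 0, hasStrictFDerivAt_const _ _, by simp⟩
  | succ n ih =>
    obtain ⟨F, hF, hF0, F', hF', hF'Y⟩ := ih (fun i => Y i.castSucc) fun i => hY _
    let r : (Fin (n + 1) → ℝ) →L[ℝ] (Fin n → ℝ) :=
      ContinuousLinearMap.pi fun i => ContinuousLinearMap.proj i.castSucc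
    let s : (Fin (n + 1) → ℝ) →L[ℝ] Matrix (Fin d) (Fin d) ℂ :=
      (ContinuousLinearMap.proj (Fin.last n)).smulRight (Y (Fin.last n))
    have h1 : HasStrictFDerivAt (fun t => F (r t)) (F'.comp r) 0 :=
      HasStrictFDerivAt.comp (g := F) 0 (by simpa using hF') r.hasStrictFDerivAt
    have h2 : HasStrictFDerivAt (fun t => NormedSpace.exp (s t))
        ((1 : Matrix (Fin d) (Fin d) ℂ →L[ℝ] Matrix (Fin d) (Fin d) ℂ).comp s) 0 :=
      HasStrictFDerivAt.comp (g := NormedSpace.exp) 0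
        (by simpa using hasStrictFDerivAt_exp_zero (𝕂 := ℝ)) s.hasStrictFDerivAt
    refine ⟨fun t => F (r t) * NormedSpace.exp (s t), ?_, by simp [hF0], _,
      hasStrictFDerivAt_mul_of_eq_one h1 h2 (by simp [hF0]) (by simp), ?_⟩
    · intro t
      obtain ⟨U, hU, h⟩ := hF (r t)
      obtain ⟨V, hV, h'⟩ := hY (Fin.last n) (t (Fin.last n))
      exact ⟨U * V, G.mul_mem hU hV, by rw [Matrix.UnitaryGroup.mul_val, h, h']; rfl⟩
    · intro t
      simp [hF'Y, r, s, Fin.sum_univ_castSucc]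

/-- A small Hermitian `K` with `1 + K` unitary vanishes: `2K = -K²`. -/
lemma eq_zero_of_isHermitian_of_one_add_mem_unitaryGroup {K : Matrix (Fin d) (Fin d) ℂ}
    (hK : K.IsHermitian) (hU : 1 + K ∈ Matrix.unitaryGroup (Fin d) ℂ) (hlt : ‖K‖ < 1) : K = 0 := by
  rw [Matrix.mem_unitaryGroup_iff, Matrix.star_eq_conjTranspose, Matrix.conjTranspose_add,
    hK.eq, Matrix.conjTranspose_one] at hU
  have h : (2 : ℝ) • K = - (K * K) := by
    have : (1 + K) * (1 + K) = 1 + ((2 : ℝ) • K + K * K) := by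
      rw [two_smul]; noncomm_ring
    rw [this] at hU
    exact eq_neg_of_add_eq_zero_left (by simpa using hU)
  have h2 : 2 * ‖K‖ ≤ ‖K‖ * ‖K‖ := by
    calc 2 * ‖K‖ = ‖(2 : ℝ) • K‖ := by rw [norm_smul]; norm_num
      _ = ‖K * K‖ := by rw [h, norm_neg]
      _ ≤ _ := norm_mul_le _ _
  have : ‖K‖ = 0 := by nlinarith [norm_nonneg K]
  exact norm_eq_zero.mp this

/-- If the directions of `G` span `𝔲(d)`, then `G` contains all unitaries near the identity.
A product of one-parameter groups times `1 + K`, `K` Hermitian, is a submersion at the identity,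
so it covers a neighbourhood of `1`; at a unitary value the factor `1 + K` is trivial. -/
lemma eventually_mem_of_lieU_subset_span
    (hspan : ∀ X ∈ lieU d, X ∈ Submodule.span ℝ (expDirections G)) :
    ∀ᶠ A in 𝓝 (1 : Matrix (Fin d) (Fin d) ℂ),
      ∀ U : Matrix.unitaryGroup (Fin d) ℂ, (U : Matrix (Fin d) (Fin d) ℂ) = A → U ∈ G := by
  obtain ⟨b, hb, hbspan, hbind⟩ := exists_linearIndependent ℝ (expDirections G)
  have hfin : b.Finite := hbind.setFinite
  obtain ⟨n, Y, hY⟩ := hfin.fin_embedding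
  have hYmem : ∀ i, Y i ∈ expDirections G := fun i => hb (hY ▸ Set.mem_range_self i)
  obtain ⟨F, hF, hF0, F', hF', hF'Y⟩ := exists_hasStrictFDerivAt_of_expDirections n Y hYmem
  let M := Matrix (Fin d) (Fin d) ℂ
  let herm : M →L[ℝ] M := ContinuousLinearMap.id ℝ M + (starL' ℝ : M ≃L[ℝ] M).toContinuousLinearMap
  let p1 : (Fin n → ℝ) × M →L[ℝ] (Fin n → ℝ) := ContinuousLinearMap.fst ℝ _ _
  let p2 : (Fin n → ℝ) × M →L[ℝ] M := herm.comp (ContinuousLinearMap.snd ℝ _ _)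
  have hp2 : ∀ x, p2 x = x.2 + star x.2 := fun x => rfl
  have h1 : HasStrictFDerivAt (fun x => F (p1 x)) (F'.comp p1) 0 :=
    HasStrictFDerivAt.comp (g := F) 0 (by simpa using hF') p1.hasStrictFDerivAt
  have h2 : HasStrictFDerivAt (fun x => 1 + p2 x) p2 0 := p2.hasStrictFDerivAt.const_add 1
  have h3 := hasStrictFDerivAt_mul_of_eq_one h1 h2 (by simp [hF0]) (by simp)
  have hsurj := h3.map_nhds_eq_of_surj (by
    rw [LinearMap.range_eq_top]
    intro X
    have hskew : (2⁻¹ : ℝ) • (X - star X) ∈ lieU d := by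
      change _ᴴ = -_
      rw [Matrix.conjTranspose_smul, Matrix.conjTranspose_sub, Matrix.star_eq_conjTranspose,
        Matrix.conjTranspose_conjTranspose, ← smul_neg, neg_sub]
      simp
    have hmem := hspan _ hskew
    rw [← hbspan, ← hY, Submodule.mem_span_range_iff_exists_fun] at hmem
    obtain ⟨c, hc⟩ := hmem
    refine ⟨(c, (4⁻¹ : ℝ) • (X + star X)), ?_⟩
    change F' c + ((4⁻¹ : ℝ) • (X + star X) + star ((4⁻¹ : ℝ) • (X + star X))) = X
    rw [hF'Y, hc, star_smul, star_add, star_star, star_trivial (4⁻¹ : ℝ)]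
    module)
  have hone : F (p1 0) * (1 + p2 0) = 1 := by simp [hF0]
  have hev : ∀ᶠ x in 𝓝 (0 : (Fin n → ℝ) × M), ‖p2 x‖ < 1 := by
    have : Tendsto (fun x => ‖p2 x‖) (𝓝 0) (𝓝 0) := by
      have := (p2.continuous.norm).tendsto 0
      simpa using this
    exact this.eventually (gt_mem_nhds one_pos)
  have hG : ∀ᶠ x in 𝓝 (0 : (Fin n → ℝ) × M), ∀ U : Matrix.unitaryGroup (Fin d) ℂ,
      (U : M) = F (p1 x) * (1 + p2 x) → U ∈ G := by
    filter_upwards [hev] with x hx U hU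
    obtain ⟨W, hW, hWF⟩ := hF (p1 x)
    have hval : ((W⁻¹ * U : Matrix.unitaryGroup (Fin d) ℂ) : M) = 1 + p2 x := by
      rw [Matrix.UnitaryGroup.mul_val, Matrix.UnitaryGroup.inv_val, hU, ← hWF, ← mul_assoc,
        Matrix.UnitaryGroup.star_mul_self, one_mul]
    have hK : p2 x = 0 := eq_zero_of_isHermitian_of_one_add_mem_unitaryGroup
      (by rw [hp2]; exact Matrix.isHermitian_add_transpose_self _) (hval ▸ (W⁻¹ * U).2) hx
    have : U = W := by
      apply Subtype.ext
      rw [hU, hK, add_zero, mul_one, hWF]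
    exact this ▸ hW
  rw [← hone, ← hsurj, eventually_map]
  exact hG

/-- Every unitary matrix is `exp (iX)` with `X` Hermitian. The spectrum is finite, so the principal
argument is continuous on it, whether or not `-1` is an eigenvalue. -/
lemma exists_expUnitary_eq (U : Matrix.unitaryGroup (Fin d) ℂ) :
    ∃ X : selfAdjoint (Matrix (Fin d) (Fin d) ℂ), selfAdjoint.expUnitary X = U := by
  refine ⟨Unitary.argSelfAdjoint U, Subtype.ext ?_⟩
  have hcont : ContinuousOn Complex.arg (spectrum ℂ (U : Matrix (Fin d) (Fin d) ℂ)) :=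
    (Matrix.finite_spectrum _).continuousOn _
  rw [selfAdjoint.expUnitary_coe, Unitary.argSelfAdjoint_coe,
    ← CFC.exp_eq_normedSpace_exp (𝕜 := ℂ), ← cfc_comp_smul .., ← cfc_comp' ..]
  conv_rhs => rw [← cfc_id' ℂ (U : Matrix (Fin d) (Fin d) ℂ)]
  refine cfc_congr fun y hy => ?_
  have hy1 : ‖y‖ = 1 := spectrum.norm_eq_one_of_unitary U.2 hy
  have := Complex.norm_mul_exp_arg_mul_I y
  rw [hy1, Complex.ofReal_one, one_mul, mul_comm] at this
  simpa [← Complex.exp_eq_exp_ℂ] using this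

/-- `exp (iX)` is the `n`-th power of `exp (iX/n)`, which is close to `1`. -/
lemma eq_top_of_lieU_subset_span
    (hspan : ∀ X ∈ lieU d, X ∈ Submodule.span ℝ (expDirections G)) : G = ⊤ := by
  rw [eq_top_iff]
  rintro U -
  obtain ⟨X, rfl⟩ := exists_expUnitary_eq U
  have hpow : ∀ (Z : selfAdjoint (Matrix (Fin d) (Fin d) ℂ)) (n : ℕ),
      selfAdjoint.expUnitary (n • Z) = selfAdjoint.expUnitary Z ^ n := by
    intro Z n
    induction n with
    | zero => simp
    | succ n ih =>
      rw [succ_nsmul, pow_succ, ← ih]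
      exact Commute.expUnitary_add ((Commute.refl (Z : Matrix (Fin d) (Fin d) ℂ)).smul_left n)
  have hlim : Tendsto (fun n : ℕ => ((selfAdjoint.expUnitary (((n : ℝ) + 1)⁻¹ • X) :
      Matrix.unitaryGroup (Fin d) ℂ) : Matrix (Fin d) (Fin d) ℂ)) atTop (𝓝 1) := by
    have hcont : Continuous fun r : ℝ => ((selfAdjoint.expUnitary (r • X) :
        Matrix.unitaryGroup (Fin d) ℂ) : Matrix (Fin d) (Fin d) ℂ) :=
      continuous_subtype_val.comp (selfAdjoint.continuous_expUnitary.comp (by fun_prop))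
    have h0 := hcont.tendsto 0
    rw [zero_smul, selfAdjoint.expUnitary_zero] at h0
    refine h0.comp ?_
    simpa using tendsto_one_div_add_atTop_nhds_zero_nat (𝕜 := ℝ)
  obtain ⟨n, hn⟩ := (hlim.eventually (eventually_mem_of_lieU_subset_span hspan)).exists
  have hX : X = (n + 1) • (((n : ℝ) + 1)⁻¹ • X) := by
    have h : ((n : ℝ) + 1) ≠ 0 := by positivity
    rw [← Nat.cast_smul_eq_nsmul ℝ, smul_smul]
    push_cast
    rw [mul_inv_cancel₀ h, one_smul]
  rw [hX, hpow]
  exact G.pow_mem (hn _ rfl) _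

end

lemma closure_torusH_union_torusH' (d : ℕ) [NeZero d] :
    Subgroup.closure ((torusH d : Set (Matrix.unitaryGroup (Fin d) ℂ)) ∪
      (torusH' d : Set (Matrix.unitaryGroup (Fin d) ℂ))) = ⊤ :=
  eq_top_of_lieU_subset_span <| lieU_subset_span_expDirections
    (fun _ h => Subgroup.subset_closure (Or.inl h))
    (fun _ h => Subgroup.subset_closure (Or.inr h))

/-! ### Maps denoted by diagrams -/

section
variable {d m n k m' n' : ℕ}

/-- A map is denoted by a diagram up to a nonzero scalar. -/
def IsDenoted (f : QuditMap d m n) : Prop :=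
  ∃ (D : Diagram d m n) (z : ℂ), z ≠ 0 ∧ D.interp = z • f

lemma Diagram.isDenoted (D : Diagram d m n) : IsDenoted D.interp :=
  ⟨D, 1, one_ne_zero, (one_smul _ _).symm⟩

lemma IsDenoted.comp {g : QuditMap d k n} {f : QuditMap d m k} (hg : IsDenoted g)
    (hf : IsDenoted f) : IsDenoted (g * f) := by
  obtain ⟨D, z, hz, h⟩ := hg
  obtain ⟨E, w, hw, h'⟩ := hf
  refine ⟨.comp D E, z * w, mul_ne_zero hz hw, ?_⟩
  rw [Diagram.interp, h, h', Matrix.smul_mul, Matrix.mul_smul, smul_smul]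

lemma IsDenoted.tensor {f : QuditMap d m n} {g : QuditMap d m' n'} (hf : IsDenoted f)
    (hg : IsDenoted g) : IsDenoted (tensorMap f g) := by
  obtain ⟨D, z, hz, h⟩ := hf
  obtain ⟨E, w, hw, h'⟩ := hg
  refine ⟨.tensor D E, z * w, mul_ne_zero hz hw, ?_⟩
  rw [Diagram.interp, h, h']
  ext y x
  simp only [tensorMap, Matrix.of_apply, Matrix.smul_apply, smul_eq_mul]
  ring

lemma IsDenoted.of_smul {f : QuditMap d m n} {c : ℂ} (hc : c ≠ 0) (h : IsDenoted (c • f)) :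
    IsDenoted f := by
  obtain ⟨D, z, hz, h⟩ := h
  exact ⟨D, z * c, mul_ne_zero hz hc, by rw [h, smul_smul]⟩

lemma IsDenoted.congr {f g : QuditMap d m n} (hf : IsDenoted f) (h : f = g) : IsDenoted g :=
  h ▸ hf

lemma IsDenoted.cast_left {f : QuditMap d m n} (hf : IsDenoted f) (h : m = m') :
    IsDenoted (f.submatrix id fun (x : Fin m' → Fin d) i => x (Fin.cast h i)) := by
  subst h
  exact hf

/-- The linear map acting on basis states by a function on their labels. -/
def mapMatrix (g : (Fin m → Fin d) → Fin n → Fin d) : QuditMap d m n :=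
  Matrix.of fun y x => if y = g x then 1 else 0

lemma mul_mapMatrix (A : QuditMap d k n) (g : (Fin m → Fin d) → Fin k → Fin d) :
    A * mapMatrix g = A.submatrix id g := by
  ext y x
  simp [Matrix.mul_apply, mapMatrix]

lemma mapMatrix_mul_mapMatrix (f : (Fin k → Fin d) → Fin n → Fin d)
    (g : (Fin m → Fin d) → Fin k → Fin d) : mapMatrix f * mapMatrix g = mapMatrix (f ∘ g) :=
  mul_mapMatrix _ _

lemma mapMatrix_id : mapMatrix (id : (Fin n → Fin d) → Fin n → Fin d) = 1 := by
  ext y x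
  simp [mapMatrix, Matrix.one_apply]

lemma eq_append_iff {α : Type*} (y : Fin (m + n) → α) (a : Fin m → α) (b : Fin n → α) :
    y = Fin.append a b ↔ (fun i => y (Fin.castAdd n i)) = a ∧ (fun i => y (Fin.natAdd m i)) = b := by
  constructor
  · rintro rfl
    exact ⟨funext fun i => by simp, funext fun i => by simp⟩
  · rintro ⟨rfl, rfl⟩
    exact (Fin.append_castAdd_natAdd (f := y)).symm

lemma tensorMap_mapMatrix (f : (Fin m → Fin d) → Fin n → Fin d)
    (g : (Fin m' → Fin d) → Fin n' → Fin d) : tensorMap (mapMatrix f) (mapMatrix g) =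
      mapMatrix fun x => Fin.append (f fun i => x (Fin.castAdd m' i))
        (g fun i => x (Fin.natAdd m i)) := by
  ext y x
  simp only [tensorMap, mapMatrix, Matrix.of_apply, eq_append_iff, ite_and]
  split_ifs <;> simp

lemma sum_append (φ : (Fin (m + n) → Fin d) → ℂ) :
    ∑ u, φ u = ∑ a : Fin m → Fin d, ∑ b : Fin n → Fin d, φ (Fin.append a b) := by
  rw [← (Fin.appendEquiv m n).sum_comp, Fintype.sum_prod_type]
  rfl

lemma isDenoted_wires (d : ℕ) : ∀ n, IsDenoted (1 : QuditMap d n n)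
  | 0 => Diagram.empty.isDenoted
  | n + 1 => by
    have h := (isDenoted_wires d n).tensor (Diagram.wire (d := d)).isDenoted
    rw [Diagram.interp, ← mapMatrix_id, ← mapMatrix_id, tensorMap_mapMatrix] at h
    convert h
    rw [← mapMatrix_id]
    congr 1
    funext x
    exact (Fin.append_castAdd_natAdd (f := x)).symm

lemma isDenoted_id (n : ℕ) : IsDenoted (mapMatrix id : QuditMap d n n) :=
  mapMatrix_id (d := d) (n := n) ▸ isDenoted_wires d n

lemma isDenoted_diagonal_prod {N : ℕ} {ι : Type*} (s : Finset ι)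
    (F : ι → (Fin N → Fin d) → ℂ)
    (hF : ∀ i ∈ s, IsDenoted (Matrix.diagonal (F i) : QuditMap d N N)) :
    IsDenoted (Matrix.diagonal (fun x => ∏ i ∈ s, F i x) : QuditMap d N N) := by
  classical
  induction s using Finset.induction_on with
  | empty => simpa using isDenoted_wires d N
  | insert i s hi ih =>
    have h := (hF i (Finset.mem_insert_self i s)).comp
      (ih fun j hj => hF j (Finset.mem_insert_of_mem hj))
    rw [Matrix.diagonal_mul_diagonal] at h
    simpa only [Finset.prod_insert hi] using h

lemma interp_cross : (Diagram.cross (d := d)).interp = mapMatrix fun x => ![x 1, x 0] := by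
  ext y x
  simp [Diagram.interp, mapMatrix, funext_iff, Fin.forall_fin_two]

lemma interp_copyZ : (Diagram.copyZ (d := d)).interp = mapMatrix fun x => ![x 0, x 0] := by
  ext y x
  simp [Diagram.interp, mapMatrix, funext_iff, Fin.forall_fin_two]

lemma isDenoted_ones_zero_left (d : ℕ) :
    ∀ n, IsDenoted (Matrix.of fun _ _ => 1 : QuditMap d 0 n)
  | 0 => by
    convert (Diagram.empty (d := d)).isDenoted
    ext y x
    simp [Diagram.interp, Matrix.one_apply, Subsingleton.elim y x]
  | n + 1 => by
    convert (isDenoted_ones_zero_left d n).tensor (Diagram.unitZ (d := d)).isDenoted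
    ext y x
    simp [tensorMap, Diagram.interp]

lemma isDenoted_ones_zero_right (d : ℕ) :
    ∀ m, IsDenoted (Matrix.of fun _ _ => 1 : QuditMap d m 0)
  | 0 => isDenoted_ones_zero_left d 0
  | m + 1 => by
    convert (isDenoted_ones_zero_right d m).tensor (Diagram.counitZ (d := d)).isDenoted
    ext y x
    simp [tensorMap, Diagram.interp]

end

/-! ### Single-qudit unitaries -/

section
variable {d : ℕ}

lemma oneQudit_mul (A B : Matrix (Fin d) (Fin d) ℂ) :
    oneQudit (A * B) = oneQudit A * oneQudit B := by
  ext y x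
  simp only [oneQudit, Matrix.of_apply, Matrix.mul_apply]
  exact ((Equiv.funUnique (Fin 1) (Fin d)).sum_comp fun t => A (y 0) t * B t (x 0)).symm

/-- The unitary is denoted by a diagram up to a global phase. -/
def IsDenotedUpToPhase (U : Matrix.unitaryGroup (Fin d) ℂ) : Prop :=
  ∃ (D : Diagram d 1 1) (z : ℂ), ‖z‖ = 1 ∧
    D.interp = z • oneQudit (U : Matrix (Fin d) (Fin d) ℂ)

lemma IsDenotedUpToPhase.mul {U W : Matrix.unitaryGroup (Fin d) ℂ} (hU : IsDenotedUpToPhase U)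
    (hW : IsDenotedUpToPhase W) : IsDenotedUpToPhase (U * W) := by
  obtain ⟨D, z, hz, h⟩ := hU
  obtain ⟨E, w, hw, h'⟩ := hW
  refine ⟨.comp D E, z * w, by rw [norm_mul, hz, hw, one_mul], ?_⟩
  rw [Diagram.interp, h, h', Matrix.smul_mul, Matrix.mul_smul, smul_smul,
    Matrix.UnitaryGroup.mul_val, oneQudit_mul]

variable [NeZero d]

lemma isDenotedUpToPhase_of_mem_torusH {U : Matrix.unitaryGroup (Fin d) ℂ} (hU : U ∈ torusH d) :
    IsDenotedUpToPhase U := by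
  obtain ⟨α, h⟩ := hU
  refine ⟨.phaseZ fun j => α j.1 - α 0, Complex.exp ((-α 0 : ℝ) * Complex.I),
    Complex.norm_exp_ofReal_mul_I _, ?_⟩
  rw [Diagram.interp, h]
  ext y x
  simp only [oneQudit, LambdaZ, Matrix.of_apply, Matrix.smul_apply, Matrix.diagonal_apply,
    smul_eq_mul, mul_ite, mul_zero, ← Complex.exp_add]
  congr 1
  unfold phase
  split_ifs with h0
  · have : y 0 = 0 := Fin.ext h0
    rw [this, ← Complex.exp_zero]
    congr 1; push_cast; ring
  · congr 1; push_cast; ring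

lemma isDenotedUpToPhase_fourierU : IsDenotedUpToPhase (fourierU d) :=
  ⟨.had, 1, norm_one, (one_smul _ _).symm⟩

lemma isDenotedUpToPhase_fourierU_inv : IsDenotedUpToPhase (fourierU d)⁻¹ :=
  ⟨.hadDagger, 1, norm_one, (one_smul _ _).symm⟩

lemma isDenotedUpToPhase (U : Matrix.unitaryGroup (Fin d) ℂ) : IsDenotedUpToPhase U := by
  have hU : U ∈ Subgroup.closure ((torusH d : Set (Matrix.unitaryGroup (Fin d) ℂ)) ∪
      (torusH' d : Set (Matrix.unitaryGroup (Fin d) ℂ))) :=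
    closure_torusH_union_torusH' d ▸ Subgroup.mem_top U
  have hH' : ∀ W ∈ torusH' d, IsDenotedUpToPhase W := by
    rintro _ ⟨W, hW, rfl⟩
    exact (isDenotedUpToPhase_fourierU.mul (isDenotedUpToPhase_of_mem_torusH hW)).mul
      isDenotedUpToPhase_fourierU_inv
  refine (Subgroup.closure_induction
    (p := fun W _ => IsDenotedUpToPhase W ∧ IsDenotedUpToPhase W⁻¹) ?_ ?_ ?_ ?_ hU).1
  · rintro W (hW | hW)
    · exact ⟨isDenotedUpToPhase_of_mem_torusH hW,
        isDenotedUpToPhase_of_mem_torusH ((torusH d).inv_mem hW)⟩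
    · exact ⟨hH' W hW, hH' _ ((torusH' d).inv_mem hW)⟩
  · have h := isDenotedUpToPhase_of_mem_torusH (torusH d).one_mem
    exact ⟨h, by simpa using h⟩
  · intro W X _ _ hW hX
    exact ⟨hW.1.mul hX.1, by rw [mul_inv_rev]; exact hX.2.mul hW.2⟩
  · intro W _ hW
    exact ⟨hW.2, by rw [inv_inv]; exact hW.1⟩

lemma isDenoted_oneQudit (U : Matrix.unitaryGroup (Fin d) ℂ) :
    IsDenoted (oneQudit (U : Matrix (Fin d) (Fin d) ℂ)) := by
  obtain ⟨D, z, hz, h⟩ := isDenotedUpToPhase U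
  exact ⟨D, z, by rintro rfl; simp at hz, h⟩

/-- Every nonzero vector is a multiple of the row `0` of a unitary matrix. -/
lemma exists_unitary_row_eq_smul {h : Fin d → ℂ} (hne : h ≠ 0) :
    ∃ (U : Matrix.unitaryGroup (Fin d) ℂ) (c : ℂ), c ≠ 0 ∧ ∀ t, U.1 0 t = c * h t := by
  set v : EuclideanSpace ℂ (Fin d) := WithLp.toLp 2 h with hv
  have hv0 : v ≠ 0 := by
    intro h0
    apply hne
    funext t
    exact congrFun (congrArg WithLp.ofLp h0) t
  have hnorm : (‖v‖ : ℂ) ≠ 0 := by exact_mod_cast norm_ne_zero_iff.mpr hv0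
  let w : Fin d → EuclideanSpace ℂ (Fin d) := fun _ => (‖v‖ : ℂ)⁻¹ • v
  have hw : Orthonormal ℂ (({0} : Set (Fin d)).domRestrict w) := by
    refine ⟨fun i => ?_, fun i j hij => (hij (Subsingleton.elim i j)).elim⟩
    simp [w, norm_smul, hv0]
  obtain ⟨b, hb⟩ := hw.exists_orthonormalBasis_extension_of_card_eq (by simp)
  refine ⟨⟨Matrix.of fun i t => b i t, ?_⟩, (‖v‖ : ℂ)⁻¹, inv_ne_zero hnorm, fun t => ?_⟩
  · rw [Matrix.mem_unitaryGroup_iff]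
    ext i j
    have := orthonormal_iff_ite.mp b.orthonormal j i
    rw [PiLp.inner_apply] at this
    simp only [Matrix.mul_apply, Matrix.star_apply, Matrix.of_apply, Matrix.one_apply]
    simp only [eq_comm (a := i) (b := j), ← this]
    refine Finset.sum_congr rfl fun t _ => ?_
    simp
  · simp [hb 0 rfl, w, hv]

/-- Every nonzero effect `⟨h|` is `⟨0|U` for a unitary `U`, up to a scalar. -/
lemma isDenoted_effect {h : Fin d → ℂ} (hne : h ≠ 0) :
    IsDenoted (Matrix.of fun _ x => h (x 0) : QuditMap d 1 0) := by
  obtain ⟨U, c, hc, hU⟩ := exists_unitary_row_eq_smul hne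
  refine IsDenoted.of_smul hc ?_
  convert (Diagram.counitX (d := d)).isDenoted.comp (isDenoted_oneQudit U)
  ext y x
  simp only [Diagram.interp, Matrix.mul_apply, Matrix.of_apply, oneQudit, Matrix.smul_apply,
    smul_eq_mul]
  have hsum := (Equiv.funUnique (Fin 1) (Fin d)).sum_comp fun t : Fin d =>
    (if (t : ℕ) = 0 then 1 else 0) * U.1 t (x 0)
  refine Eq.trans ?_ hsum.symm
  rw [Finset.sum_eq_single 0]
  · simp [hU]
  · intro t _ ht
    have h0 : ¬ (t : ℕ) = 0 := fun h0 => ht (Fin.ext h0)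
    simp only [h0, if_false, zero_mul]
  · simp

end

/-! ### Linear functions of the labels -/

section
variable {d : ℕ} [NeZero d]

lemma omega_pow_val_add (s t : Fin d) :
    omega d ^ ((s + t : Fin d) : ℕ) = omega d ^ (s : ℕ) * omega d ^ (t : ℕ) := by
  rw [Fin.val_add, ← pow_add, ← pow_eq_pow_mod _ (omega_isPrimitiveRoot d).pow_eq_one]

lemma omega_pow_val_nsmul (a : ℕ) (t : Fin d) :
    omega d ^ ((a • t : Fin d) : ℕ) = omega d ^ (a * (t : ℕ)) := by
  induction a with
  | zero => simp
  | succ a ih => rw [succ_nsmul, omega_pow_val_add, ih, ← pow_add, Nat.succ_mul]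

lemma omega_pow_val_sum {ι : Type*} (s : Finset ι) (f : ι → Fin d) :
    omega d ^ ((∑ i ∈ s, f i : Fin d) : ℕ) = ∏ i ∈ s, omega d ^ (f i : ℕ) := by
  classical
  induction s using Finset.induction_on with
  | empty => simp
  | insert i s hi ih => rw [Finset.sum_insert hi, Finset.prod_insert hi, omega_pow_val_add, ih]

/-- Multiplication in the X basis is addition modulo `d` of the labels, up to a scalar. -/
lemma isDenoted_add :
    IsDenoted (mapMatrix fun x => ![x 0 + x 1] : QuditMap d 2 1) := by
  have hd : (Real.sqrt d : ℂ) ≠ 0 := by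
    exact_mod_cast (Real.sqrt_pos.mpr (Nat.cast_pos.mpr (NeZero.pos d))).ne'
  refine IsDenoted.of_smul (inv_ne_zero hd) ?_
  convert (Diagram.mergeX (d := d)).isDenoted
  ext y x
  have hs : (Real.sqrt d : ℂ) * (Real.sqrt d : ℂ) = (d : ℂ) := by
    rw [← Complex.ofReal_mul, Real.mul_self_sqrt (Nat.cast_nonneg d)]; simp
  have hterm : ∀ l : Fin d, chi l (y 0) * (star (chi l (x 0)) * star (chi l (x 1))) =
      ((Real.sqrt d : ℂ)⁻¹) ^ 3 * (star (omega d) ^ ((l : ℕ) * ((x 0 + x 1 : Fin d) : ℕ)) *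
        omega d ^ ((l : ℕ) * (y 0 : ℕ))) := by
    intro l
    have h : star (omega d) ^ ((l : ℕ) * ((x 0 + x 1 : Fin d) : ℕ)) =
        star (omega d) ^ ((x 0 : ℕ) * (l : ℕ)) * star (omega d) ^ ((x 1 : ℕ) * (l : ℕ)) := by
      rw [← star_pow, ← star_pow, ← star_pow, ← star_mul', mul_comm, pow_mul, omega_pow_val_add,
        mul_pow, ← pow_mul, ← pow_mul]
    rw [h]
    simp only [chi, fourierMatrix, Matrix.of_apply, star_mul', star_pow, star_inv₀,
      Complex.star_def, Complex.conj_ofReal]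
    rw [mul_comm (l : ℕ) (y 0 : ℕ)]
    ring
  simp only [Diagram.interp, Matrix.of_apply, hterm, Matrix.smul_apply, mapMatrix, smul_eq_mul]
  rw [← Finset.mul_sum, sum_omega]
  have hy : y = ![x 0 + x 1] ↔ x 0 + x 1 = y 0 := by
    constructor
    · rintro rfl; rfl
    · intro h; ext i; fin_cases i; simp [h]
  simp only [hy]
  split_ifs
  · rw [← hs]; field_simp
  · simp

lemma interp_unitX : (Diagram.unitX (d := d)).interp = mapMatrix fun _ => ![0] := by
  ext y x
  have h : y = ![0] ↔ (y 0 : ℕ) = 0 := by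
    rw [funext_iff, Fin.forall_fin_one]
    exact Fin.ext_iff
  simp only [Diagram.interp, mapMatrix, Matrix.of_apply, h]

/-- `|t, x⟩ ↦ |x, t + x⟩`: copy `x`, move `t` past it and add. -/
lemma isDenoted_swapAdd :
    IsDenoted (mapMatrix fun x => ![x 1, x 0 + x 1] : QuditMap d 2 2) := by
  have hcopy := (Diagram.copyZ (d := d)).isDenoted
  have hcross := (Diagram.cross (d := d)).isDenoted
  rw [interp_copyZ] at hcopy
  rw [interp_cross] at hcross
  have h1 := (isDenoted_id (d := d) 1).tensor hcopy
  have h2 := hcross.tensor (isDenoted_id (d := d) 1)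
  have h3 := (isDenoted_id (d := d) 1).tensor (isDenoted_add (d := d))
  rw [tensorMap_mapMatrix] at h1 h2 h3
  have h := h3.comp (m := 2) (h2.comp (k := 3) (m := 2) h1)
  rw [mapMatrix_mul_mapMatrix, mapMatrix_mul_mapMatrix] at h
  convert h using 2
  funext x i
  fin_cases i <;> rfl

/-- `|t, x⟩ ↦ |x, t + ax⟩`. -/
lemma isDenoted_swapAddMul (a : ℕ) :
    IsDenoted (mapMatrix fun x => ![x 1, x 0 + a • x 1] : QuditMap d 2 2) := by
  have hcross := (Diagram.cross (d := d)).isDenoted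
  rw [interp_cross] at hcross
  induction a with
  | zero => simpa using hcross
  | succ a ih =>
    have h := isDenoted_swapAdd.comp (hcross.comp ih)
    rw [mapMatrix_mul_mapMatrix, mapMatrix_mul_mapMatrix] at h
    convert h using 2
    funext x i
    fin_cases i
    · rfl
    · simp [succ_nsmul, add_assoc]

/-- `|t, x₁, …, x_N⟩ ↦ |x₁, …, x_N, t + ∑ aᵢ xᵢ⟩`: the first wire is carried across the others and
collects their labels on the way. -/
lemma isDenoted_linearForm (N : ℕ) (a : Fin N → ℕ) :
    IsDenoted (mapMatrix fun x => Fin.snoc (α := fun _ => Fin d) (fun i => x (Fin.natAdd 1 i))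
      (x (Fin.castAdd N 0) + ∑ i, a i • x (Fin.natAdd 1 i)) : QuditMap d (1 + N) (N + 1)) := by
  induction N with
  | zero =>
    refine (isDenoted_id (d := d) 1).congr (congrArg mapMatrix (funext fun x => funext fun i => ?_))
    refine Fin.lastCases ?_ (fun j => j.elim0) i
    rw [Fin.snoc_last, Finset.univ_eq_empty, Finset.sum_empty, add_zero]
    rfl
  | succ N ih =>
    have h1 := (ih fun i => a i.castSucc).tensor (isDenoted_id (d := d) 1)
    have h2 := (isDenoted_id (d := d) N).tensor (isDenoted_swapAddMul (a (Fin.last N)))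
    rw [tensorMap_mapMatrix] at h1 h2
    have h := h2.comp h1
    rw [mapMatrix_mul_mapMatrix] at h
    refine h.congr (congrArg mapMatrix (funext fun x => funext fun i => ?_))
    refine Fin.lastCases ?_ (fun j => Fin.lastCases ?_ (fun j => ?_) j) i
    · rw [Fin.snoc_last, Fin.sum_univ_castSucc, ← add_assoc]
      refine (Fin.append_right _ _ (1 : Fin 2)).trans ?_
      refine congrArg₂ (· + ·) ?_ ?_
      · exact (Fin.append_left _ _ (Fin.last N)).trans (Fin.snoc_last _ _)
      · exact congrArg (a (Fin.last N) • ·) (Fin.append_right _ _ (0 : Fin 1))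
    · rw [Fin.snoc_castSucc]
      refine (Fin.append_right _ _ (0 : Fin 2)).trans ?_
      exact Fin.append_right _ _ (0 : Fin 1)
    · rw [Fin.snoc_castSucc]
      refine (Fin.append_left _ _ j).trans ?_
      refine (Fin.append_left _ _ j.castSucc).trans ?_
      exact Fin.snoc_castSucc _ _ _

/-! ### Diagonal maps -/

/-- The map multiplying `|x⟩` by `h (∑ aᵢ xᵢ)`. -/
lemma isDenoted_diagonal_linearForm (N : ℕ) (a : Fin N → ℕ) {h : Fin d → ℂ} (hne : h ≠ 0) :
    IsDenoted (Matrix.diagonal fun x => h (∑ i, a i • x i) : QuditMap d N N) := by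
  have hunit := (Diagram.unitX (d := d)).isDenoted
  rw [interp_unitX] at hunit
  have h1 := hunit.tensor (isDenoted_id (d := d) N)
  rw [tensorMap_mapMatrix] at h1
  have h2 : IsDenoted (mapMatrix fun x => Fin.snoc (α := fun _ => Fin d) x (∑ i, a i • x i) :
      QuditMap d N (N + 1)) := by
    have h3 := ((isDenoted_linearForm N a).comp h1).cast_left (Nat.zero_add N)
    rw [mapMatrix_mul_mapMatrix] at h3
    refine h3.congr (congrArg mapMatrix (funext fun x => ?_))
    have hx : ∀ i, Fin.append ![(0 : Fin d)] (id fun i => x (Fin.cast (Nat.zero_add N)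
        (Fin.natAdd 0 i))) (Fin.natAdd 1 i) = x i := fun i =>
      (Fin.append_right _ _ i).trans (congrArg x (Fin.cast_natAdd_zero _ _))
    have h0 : Fin.append ![(0 : Fin d)] (id fun i => x (Fin.cast (Nat.zero_add N)
        (Fin.natAdd 0 i))) (Fin.castAdd N 0) = 0 := Fin.append_left _ _ (0 : Fin 1)
    refine congrArg₂ (Fin.snoc (α := fun _ => Fin d)) (funext hx) ?_
    refine (congrArg₂ (· + ·) h0 (Finset.sum_congr rfl fun i _ => ?_)).trans (zero_add _)
    exact congrArg (a i • ·) (hx i)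
  have h4 := ((isDenoted_id (d := d) N).tensor (isDenoted_effect hne)).comp h2
  rw [mul_mapMatrix] at h4
  refine h4.congr (Matrix.ext fun y x => ?_)
  have hinit : (fun i => Fin.snoc (α := fun _ => Fin d) x (∑ i, a i • x i) (Fin.castAdd 1 i)) = x :=
    funext fun i => Fin.snoc_castSucc _ _ _
  have hlast : Fin.snoc (α := fun _ => Fin d) x (∑ i, a i • x i) (Fin.natAdd N 0) =
    ∑ i, a i • x i := Fin.snoc_last _ _
  simp only [Matrix.submatrix_apply, id_eq, tensorMap, mapMatrix, Matrix.of_apply, hinit, hlast]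
  change (if y = x then 1 else 0) * _ = _
  rw [Matrix.diagonal_apply]
  split_ifs with hyx
  · rw [one_mul, hyx]
  · rw [zero_mul]

/-- Fourier expansion on `(ℤ/d)^N`. -/
lemma exists_fourier_expansion {N : ℕ} (F : (Fin N → Fin d) → ℂ) :
    ∃ c : (Fin N → Fin d) → ℂ, ∀ x,
      F x = ∑ a, c a * omega d ^ ((∑ i, (a i : ℕ) • x i : Fin d) : ℕ) := by
  have hd : (d : ℂ) ≠ 0 := by exact_mod_cast NeZero.ne d
  refine ⟨fun a => ((d : ℂ) ^ N)⁻¹ *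
    ∑ y, F y * ∏ i, star (omega d) ^ ((a i : ℕ) * (y i : ℕ)), fun x => ?_⟩
  have horth : ∀ y : Fin N → Fin d, ∑ a : Fin N → Fin d,
      (∏ i, star (omega d) ^ ((a i : ℕ) * (y i : ℕ))) *
        ∏ i, omega d ^ ((a i : ℕ) * (x i : ℕ)) = if y = x then (d : ℂ) ^ N else 0 := by
    intro y
    simp only [← Finset.prod_mul_distrib]
    rw [← Fintype.piFinset_univ, ← Finset.prod_univ_sum (fun _ => Finset.univ)
      fun i (l : Fin d) => star (omega d) ^ ((l : ℕ) * (y i : ℕ)) * omega d ^ ((l : ℕ) * (x i : ℕ))]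
    simp only [sum_omega]
    split_ifs with h
    · simp [h]
    · obtain ⟨i, hi⟩ := Function.ne_iff.mp h
      exact Finset.prod_eq_zero (Finset.mem_univ i) (if_neg hi)
  simp only [omega_pow_val_sum, omega_pow_val_nsmul, mul_assoc, Finset.sum_mul]
  rw [← Finset.mul_sum, Finset.sum_comm]
  simp only [← Finset.mul_sum, horth]
  simp only [mul_ite, mul_zero, Finset.sum_ite_eq', Finset.mem_univ, if_true]
  field_simp

/-- The exponential of a Fourier expansion is a product of functions of linear forms. -/
lemma isDenoted_diagonal {N : ℕ} {T : (Fin N → Fin d) → ℂ} (hT : ∀ x, T x ≠ 0) :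
    IsDenoted (Matrix.diagonal T : QuditMap d N N) := by
  obtain ⟨c, hc⟩ := exists_fourier_expansion fun x => Complex.log (T x)
  have hTc : T = fun x => ∏ a : Fin N → Fin d,
      Complex.exp (c a * omega d ^ ((∑ i, (a i : ℕ) • x i : Fin d) : ℕ)) := by
    funext x
    rw [← Complex.exp_sum, ← hc, Complex.exp_log (hT x)]
  rw [hTc]
  refine isDenoted_diagonal_prod _ (fun a x =>
    Complex.exp (c a * omega d ^ ((∑ i, (a i : ℕ) • x i : Fin d) : ℕ))) fun a _ => ?_
  refine isDenoted_diagonal_linearForm N (fun i => (a i : ℕ))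
    (h := fun t => Complex.exp (c a * omega d ^ (t : ℕ))) fun h0 => ?_
  exact Complex.exp_ne_zero _ (congrFun h0 0)

/-! ### Universality -/

/-- Feed all basis states into the output wires, weight by the entries of `f` and discard the
input wires. -/
lemma isDenoted_of_forall_ne_zero {m n : ℕ} (f : QuditMap d m n) (hf : ∀ y x, f y x ≠ 0) :
    IsDenoted f := by
  have h1 := (isDenoted_ones_zero_left d n).tensor (isDenoted_id (d := d) m)
  have h2 := isDenoted_diagonal (d := d) (N := n + m) (T := fun u =>
    f (fun i => u (Fin.castAdd m i)) (fun i => u (Fin.natAdd n i))) fun u => hf _ _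
  have h3 := (isDenoted_id (d := d) n).tensor (isDenoted_ones_zero_right d m)
  have h := (h3.comp (h2.comp h1)).cast_left (Nat.zero_add m)
  refine h.congr (Matrix.ext fun y x => ?_)
  rw [Matrix.submatrix_apply, id_eq, Matrix.mul_apply, sum_append]
  have hx : (fun i => x (Fin.cast (Nat.zero_add m) (Fin.natAdd 0 i))) = x :=
    funext fun i => congrArg x (Fin.cast_natAdd_zero _ _)
  simp only [Matrix.diagonal_mul, tensorMap, mapMatrix, Matrix.of_apply, Fin.append_left,
    Fin.append_right, id_eq, hx]
  change ∑ a, ∑ b, (if y = a then (1 : ℂ) else 0) * 1 * (f a b * (1 * if b = x then 1 else 0)) = _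
  simp

/-- A map with zero entries is a difference of two maps without, which an additional output wire
carries side by side until the effect `⟨0| - ⟨1|` subtracts them. -/
lemma isDenoted (hd : 2 ≤ d) {m n : ℕ} (f : QuditMap d m n) : IsDenoted f := by
  let h : Fin d → ℂ := fun t => if t = ⟨0, by omega⟩ then 1 else if t = ⟨1, by omega⟩ then -1 else 0
  have hne : h ≠ 0 := fun h0 => by simpa [h] using congrFun h0 ⟨0, by omega⟩
  let B : QuditMap d m n := Matrix.of fun y x => if f y x = 0 then 1 else f y x
  have hB : ∀ y x, B y x ≠ 0 := fun y x => by
    simp only [B, Matrix.of_apply]; split_ifs with h0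
    · exact one_ne_zero
    · exact h0
  have hA : ∀ y x, f y x + B y x ≠ 0 := fun y x => by
    simp only [B, Matrix.of_apply]; split_ifs with h0
    · simp [h0]
    · rw [← two_mul]; exact mul_ne_zero two_ne_zero h0
  have h1 := isDenoted_of_forall_ne_zero (d := d) (m := m) (n := n + 1) (Matrix.of fun u x =>
    if u (Fin.natAdd n 0) = ⟨0, by omega⟩ then
      f (fun i => u (Fin.castAdd 1 i)) x + B (fun i => u (Fin.castAdd 1 i)) x
    else B (fun i => u (Fin.castAdd 1 i)) x) (fun u x => by
      rw [Matrix.of_apply]; split_ifs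
      · exact hA _ _
      · exact hB _ _)
  have h2 := ((isDenoted_id (d := d) n).tensor (isDenoted_effect hne)).comp h1
  refine h2.congr (Matrix.ext fun y x => ?_)
  rw [Matrix.mul_apply, sum_append]
  simp only [tensorMap, mapMatrix, Matrix.of_apply, Fin.append_left, Fin.append_right, id_eq]
  change ∑ a, ∑ b : Fin 1 → Fin d, (if y = a then (1 : ℂ) else 0) * h (b 0) *
    (if b 0 = ⟨0, by omega⟩ then f a x + B a x else B a x) = f y x
  have hsum : ∀ a, ∑ b : Fin 1 → Fin d, (if y = a then (1 : ℂ) else 0) * h (b 0) *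
      (if b 0 = ⟨0, by omega⟩ then f a x + B a x else B a x) = if y = a then f a x else 0 := by
    intro a
    refine ((Equiv.funUnique (Fin 1) (Fin d)).sum_comp fun t =>
      (if y = a then (1 : ℂ) else 0) * h t *
        (if t = ⟨0, by omega⟩ then f a x + B a x else B a x)).trans ?_
    rw [Fintype.sum_eq_add (⟨0, by omega⟩ : Fin d) ⟨1, by omega⟩ (by simp)]
    · simp only [h, if_true]
      split_ifs <;> simp_all
    · rintro t ⟨h0, h1⟩
      simp only [h, if_neg h0, if_neg h1, mul_zero, zero_mul]
  simp only [hsum, Finset.sum_ite_eq, Finset.mem_univ, if_true]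

end

end QuditZX

theorem theorem1 (d : ℕ) [NeZero d] (hd : 2 ≤ d) :
    -- `𝔪` contains every `σ_x^{(jk)}` and every `σ_y^{(jk)}`
    (∀ j k : Fin d, j < k →
      QuditZX.sigmaX j k ∈ QuditZX.lieM d ∧ QuditZX.sigmaY j k ∈ QuditZX.lieM d) ∧
    -- `𝔪` is all of `𝔲(d)`
    QuditZX.lieM d = QuditZX.lieU d ∧
    -- `H` and `H'` generate `U(d)`
    Subgroup.closure ((QuditZX.torusH d : Set (Matrix.unitaryGroup (Fin d) ℂ)) ∪
      (QuditZX.torusH' d : Set (Matrix.unitaryGroup (Fin d) ℂ))) = ⊤ ∧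
    -- every single-qudit unitary is the interpretation of a diagram, up to a global phase
    (∀ U : Matrix.unitaryGroup (Fin d) ℂ, ∃ (D : QuditZX.Diagram d 1 1) (z : ℂ), ‖z‖ = 1 ∧
      D.interp = z • QuditZX.oneQudit (U : Matrix (Fin d) (Fin d) ℂ)) ∧
    -- every linear map between qudit systems is the interpretation of a diagram, up to a scalar
    (∀ (m n : ℕ) (f : QuditZX.QuditMap d m n), ∃ (D : QuditZX.Diagram d m n) (z : ℂ), z ≠ 0 ∧
      D.interp = z • f) := by
  refine ⟨fun j k hjk => ⟨QuditZX.sigmaX_mem_lieM hjk.ne, QuditZX.sigmaY_mem_lieM hjk.ne⟩,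
    QuditZX.lieM_eq_lieU d, QuditZX.closure_torusH_union_torusH' d,
    QuditZX.isDenotedUpToPhase, fun _ _ f => QuditZX.isDenoted hd f⟩
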